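/- Let $\mathbb{K}$ be $\mathbb{R}$ or $\mathbb{C}$, and let $X\in\mathbb{K}^{N\times T}$ be a matrix of rank $r\ge 1$ with thin singular value decomposition $X=U\Sigma V^{*}$, where $U\in\mathbb{K}^{N\times r}$ and $V\in\mathbb{K}^{T\times r}$ have orthonormal columns and $\Sigma\in\mathbb{R}^{r\times r}$ is diagonal with the positive singular values on its diagonal. For a matrix $A$ put $\|A\|_{2,\infty}=\max_i\big(\sum_j|A(i,j)|^2\big)^{1/2}$. Suppose that $X$ is $\{\mu_1,\mu_2\}$-incoherent, that is, $1\le\mu_1\le N/r$, $1\le\mu_2\le T/r$, $$\frac{N}{r}\,\|U\|_{2,\infty}^2\le\mu_1\quad\text{and}\quad\frac{T}{r}\,\|V\|_{2,\infty}^2\le\mu_2 .$$ Let $0<\delta<1$ and $0<\epsilon<1$. Draw a set $\mathcal{I}\subseteq\{1,\dots,N\}$ of row indices and, independently, a set $\mathcal{J}\subseteq\{1,\dots,T\}$ of column indices, each uniformly without replacement and of a fixed size (that is, uniformly among all subsets of that size), where $$|\mathcal{I}|\ge 3r\mu_1\frac{\ln(2r/\delta)}{\epsilon^2},\qquad |\mathcal{J}|\ge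 3r\mu_2\frac{\ln(2r/\delta)}{\epsilon^2}.$$ Then the row submatrix $X(\mathcal{I},:)$ satisfies $\operatorname{rank}X(\mathcal{I},:)=r$ with probability at least $1-\delta$, and the submatrix $X(\mathcal{I},\mathcal{J})$ satisfies $\operatorname{rank}X(\mathcal{I},\mathcal{J})=r$ with probability at least $(1-\delta)^2$. -/

import Mathlib

open scoped Matrix

noncomputable section

/-- The largest row-wise `ℓ²`-norm `‖U‖_{2,∞}` of a matrix. -/
def twoInftyNorm {𝕜 : Type*} [RCLike 𝕜] {n r : ℕ} (U : Matrix (Fin n) (Fin r) 𝕜) : ℝ :=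
  ⨆ i : Fin n, Real.sqrt (∑ j : Fin r, ‖U i j‖ ^ 2)

/-- `X = U Σ Vᴴ` is a thin singular value decomposition with `r` positive singular values
`σ 0 ≥ σ 1 ≥ …`: `U` and `V` have orthonormal columns and `Σ = diag σ`. -/
structure IsThinSVD {𝕜 : Type*} [RCLike 𝕜] {N T r : ℕ} (X : Matrix (Fin N) (Fin T) 𝕜)
    (U : Matrix (Fin N) (Fin r) 𝕜) (σ : Fin r → ℝ) (V : Matrix (Fin T) (Fin r) 𝕜) : Prop where
  left_orthonormal : Uᴴ * U = 1
  right_orthonormal : Vᴴ * V = 1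
  pos : ∀ i, 0 < σ i
  antitone : Antitone σ
  eq : X = U * Matrix.diagonal (fun i => (σ i : 𝕜)) * Vᴴ

/-- `{μ₁, μ₂}`-incoherence of a rank-`r` matrix. The row norms of `U` and `V` do not depend on
the thin singular value decomposition chosen, so one decomposition is enough. -/
def IsIncoherent {𝕜 : Type*} [RCLike 𝕜] {N T : ℕ} (X : Matrix (Fin N) (Fin T) 𝕜) (r : ℕ)
    (μ₁ μ₂ : ℝ) : Prop :=
  (1 ≤ μ₁ ∧ μ₁ ≤ (N : ℝ) / r) ∧ (1 ≤ μ₂ ∧ μ₂ ≤ (T : ℝ) / r) ∧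
    ∃ (U : Matrix (Fin N) (Fin r) 𝕜) (σ : Fin r → ℝ) (V : Matrix (Fin T) (Fin r) 𝕜),
      IsThinSVD X U σ V ∧
      (N : ℝ) / r * twoInftyNorm U ^ 2 ≤ μ₁ ∧ (T : ℝ) / r * twoInftyNorm V ^ 2 ≤ μ₂

/-- A set of `m` indices drawn from `n` indices uniformly without replacement. -/
def uniformSubset (n m : ℕ) (h : m ≤ n) : PMF (Finset (Fin n)) :=
  PMF.uniformOfFinset (Finset.powersetCard m Finset.univ)
    (Finset.powersetCard_nonempty.2 (by simpa using h))

/-- Draw `m` of `N` row indices uniformly without replacement, then, independently, `l` of `T`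
column indices uniformly without replacement. -/
def subsetSampling (N T m l : ℕ) (hm : m ≤ N) (hl : l ≤ T) :
    PMF (Finset (Fin N) × Finset (Fin T)) :=
  (uniformSubset N m hm).bind fun I => (uniformSubset T l hl).map fun J => (I, J)

/-- The row submatrix `X(I, :)`. -/
def rowSubmatrix {𝕜 : Type*} {N T : ℕ} (X : Matrix (Fin N) (Fin T) 𝕜) (I : Finset (Fin N)) :
    Matrix I (Fin T) 𝕜 :=
  X.submatrix (fun i => (i : Fin N)) id

/-- The submatrix `X(I, J)`. -/
def rowColSubmatrix {𝕜 : Type*} {N T : ℕ} (X : Matrix (Fin N) (Fin T) 𝕜) (I : Finset (Fin N))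
    (J : Finset (Fin T)) : Matrix I J 𝕜 :=
  X.submatrix (fun i => (i : Fin N)) (fun j => (j : Fin T))

end

/-! No matrix concentration is needed; an averaging argument over the sampled set suffices. The rows
of `U` form a Parseval frame of an `r`-dimensional space, with squared norms at most `B = r * μ /
N`. If the rows sampled so far span a subspace of codimension `d`, at least `d / B` rows lie outside
it (`finrank_sub_le_mul_card_notMem`), so one more uniform draw multiplies the mean codimension by
at most `1 - 1 / (N * B)`. After `m` draws the mean is at most `r * exp (-m / (r * μ))`, and since a
nonzero codimension is at least 1, Markov's inequality bounds the failure probability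
(`card_not_spanning_le`). The same holds for `V`. Finally `X(I, J)` factors as `U_I Σ V_Jᴴ`, which
has rank `r` once both outer factors do, and independence multiplies the probabilities. -/

open Finset Module

/-! ### Random subsets of a Parseval frame -/

section Frame

variable {𝕜 E ι : Type*} [RCLike 𝕜] [NormedAddCommGroup E] [InnerProductSpace 𝕜 E]
  [FiniteDimensional 𝕜 E]

/-- The codimension of the span of the vectors indexed by `I`. -/
noncomputable def spanDeficiency (𝕜 : Type*) {E ι : Type*} [RCLike 𝕜] [NormedAddCommGroup E]
    [InnerProductSpace 𝕜 E] (u : ι → E) (I : Finset ι) : ℝ :=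
  finrank 𝕜 E - finrank 𝕜 (Submodule.span 𝕜 (u '' I))

theorem spanDeficiency_nonneg (u : ι → E) (I : Finset ι) : 0 ≤ spanDeficiency 𝕜 u I := by
  have := (Submodule.span 𝕜 (u '' I)).finrank_le
  rw [spanDeficiency, sub_nonneg]
  exact_mod_cast this

theorem one_le_spanDeficiency (u : ι → E) (I : Finset ι)
    (h : finrank 𝕜 (Submodule.span 𝕜 (u '' I)) ≠ finrank 𝕜 E) :
    1 ≤ spanDeficiency 𝕜 u I := by
  have := lt_of_le_of_ne (Submodule.span 𝕜 (u '' I)).finrank_le h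
  rw [spanDeficiency, le_sub_iff_add_le, add_comm]
  exact_mod_cast this

open Classical in
theorem spanDeficiency_insert_le [DecidableEq ι] (u : ι → E) (I : Finset ι) (i : ι) :
    spanDeficiency 𝕜 u (insert i I) ≤
      spanDeficiency 𝕜 u I - if u i ∉ Submodule.span 𝕜 (u '' I) then 1 else 0 := by
  have hle : Submodule.span 𝕜 (u '' I) ≤ Submodule.span 𝕜 (u '' (insert i I : Finset ι)) :=
    Submodule.span_mono (Set.image_mono (by simp))
  unfold spanDeficiency
  split_ifs with h
  · have : (finrank 𝕜 (Submodule.span 𝕜 (u '' I)) : ℝ) ≤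
        finrank 𝕜 (Submodule.span 𝕜 (u '' (insert i I : Finset ι))) := by
      exact_mod_cast Submodule.finrank_mono hle
    linarith
  · have hlt : Submodule.span 𝕜 (u '' I) < Submodule.span 𝕜 (u '' (insert i I : Finset ι)) :=
      lt_of_le_of_ne hle fun heq =>
        h (by rw [heq]; exact Submodule.subset_span (Set.mem_image_of_mem u (by simp)))
    have : (finrank 𝕜 (Submodule.span 𝕜 (u '' I)) : ℝ) + 1 ≤
        finrank 𝕜 (Submodule.span 𝕜 (u '' (insert i I : Finset ι))) := by
      exact_mod_cast Submodule.finrank_lt_finrank_of_lt hlt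
    linarith

variable [Fintype ι]

open Classical in
/-- Many vectors of a Parseval frame with bounded norms lie outside a given subspace. -/
theorem finrank_sub_le_mul_card_notMem (u : ι → E) (B : ℝ)
    (hu : ∀ e : E, ∑ i, ‖inner 𝕜 e (u i)‖ ^ 2 = ‖e‖ ^ 2) (hB : ∀ i, ‖u i‖ ^ 2 ≤ B)
    (W : Submodule 𝕜 E) :
    (finrank 𝕜 E : ℝ) - finrank 𝕜 W ≤ B * #{i | u i ∉ W} := by
  have hdim : (finrank 𝕜 W : ℝ) + finrank 𝕜 Wᗮ = finrank 𝕜 E := by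
    exact_mod_cast W.finrank_add_finrank_orthogonal
  let b := stdOrthonormalBasis 𝕜 Wᗮ
  have hb : Orthonormal 𝕜 (fun k => (b k : E)) :=
    b.orthonormal.comp_linearIsometry Wᗮ.subtypeₗᵢ
  -- The codimension is the sum of the `‖b k‖ ^ 2`, which Parseval turns into a sum over the frame.
  -- Vectors in `W` contribute nothing; by Bessel, each other one contributes at most `B`.
  calc (finrank 𝕜 E : ℝ) - finrank 𝕜 W
      = ∑ k, ‖(b k : E)‖ ^ 2 := by
        simp_rw [hb.1]
        simp [← hdim]
    _ = ∑ i, ∑ k, ‖inner 𝕜 (b k : E) (u i)‖ ^ 2 := by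
        rw [sum_comm]; simp_rw [hu]
    _ ≤ ∑ i, if u i ∉ W then B else 0 := by
        refine sum_le_sum fun i _ => ?_
        split_ifs with h
        · refine (sum_eq_zero fun k _ => ?_).le
          rw [Submodule.inner_left_of_mem_orthogonal h (b k).2]
          simp
        · exact (hb.sum_inner_products_le (u i)).trans (hB i)
    _ = B * #{i | u i ∉ W} := by
        rw [← sum_filter, sum_const, nsmul_eq_mul, mul_comm]

variable [DecidableEq ι]

theorem sum_spanDeficiency_insert_le (u : ι → E) (B : ℝ) (hB₀ : 0 < B)
    (hu : ∀ e : E, ∑ i, ‖inner 𝕜 e (u i)‖ ^ 2 = ‖e‖ ^ 2) (hB : ∀ i, ‖u i‖ ^ 2 ≤ B)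
    (I : Finset ι) :
    ∑ i ∈ Iᶜ, spanDeficiency 𝕜 u (insert i I) ≤
      ((Fintype.card ι - #I : ℕ) : ℝ) * (1 - 1 / (Fintype.card ι * B)) *
        spanDeficiency 𝕜 u I := by
  classical
  set d := spanDeficiency 𝕜 u I with hd
  have hd₀ : 0 ≤ d := spanDeficiency_nonneg u I
  have hcount : d / B ≤ #{i | u i ∉ Submodule.span 𝕜 (u '' I)} := by
    rw [div_le_iff₀' hB₀]
    exact finrank_sub_le_mul_card_notMem u B hu hB _
  -- Sampled vectors lie in the span, so restricting to `Iᶜ` loses none of the useful ones.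
  have hfilter : {i ∈ Iᶜ | u i ∉ Submodule.span 𝕜 (u '' I)} =
      ({i | u i ∉ Submodule.span 𝕜 (u '' I)} : Finset ι) := by
    ext i
    simp only [mem_filter, mem_compl, mem_univ, true_and, and_iff_right_iff_imp]
    exact fun h hi => h (Submodule.subset_span (Set.mem_image_of_mem u hi))
  have hsum : ∑ i ∈ Iᶜ, spanDeficiency 𝕜 u (insert i I) ≤
      ((Fintype.card ι - #I : ℕ) : ℝ) * d - d / B := by
    calc _ ≤ ∑ i ∈ Iᶜ, (d - if u i ∉ Submodule.span 𝕜 (u '' I) then (1 : ℝ) else 0) :=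
          sum_le_sum fun i _ => spanDeficiency_insert_le u I i
      _ = ((Fintype.card ι - #I : ℕ) : ℝ) * d -
          #{i | u i ∉ Submodule.span 𝕜 (u '' I)} := by
          rw [sum_sub_distrib, sum_const, card_compl, nsmul_eq_mul, ← sum_filter, hfilter]
          simp
      _ ≤ _ := by linarith
  refine hsum.trans ?_
  -- Weakening `#Iᶜ` to `card ι` makes the contraction factor independent of `#I`.
  have hfrac : ((Fintype.card ι - #I : ℕ) : ℝ) / Fintype.card ι ≤ 1 :=
    div_le_one_of_le₀ (by exact_mod_cast Nat.sub_le _ _) (by positivity)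
  have hdB : 0 ≤ d / B := by positivity
  have hmul := mul_le_mul_of_nonneg_right hfrac hdB
  have : ((Fintype.card ι - #I : ℕ) : ℝ) * (1 - 1 / (Fintype.card ι * B)) * d =
      ((Fintype.card ι - #I : ℕ) : ℝ) * d -
        ((Fintype.card ι - #I : ℕ) : ℝ) / Fintype.card ι * (d / B) := by
    rw [one_div, mul_inv]; ring
  linarith

/-- Double counting: each set of size `j + 1` arises by insertion once for each of its elements. -/
theorem sum_powersetCard_sum_insert (j : ℕ) (f : Finset ι → ℝ) :
    ∑ I ∈ powersetCard j univ, ∑ i ∈ Iᶜ, f (insert i I) =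
      (j + 1) * ∑ I ∈ powersetCard (j + 1) univ, f I := by
  have : ∑ I ∈ powersetCard (j + 1) (univ : Finset ι), ∑ _i ∈ I, f I =
      (j + 1) * ∑ I ∈ powersetCard (j + 1) univ, f I := by
    rw [mul_sum]
    refine sum_congr rfl fun I hI => ?_
    rw [sum_const, (mem_powersetCard.1 hI).2, nsmul_eq_mul]
    push_cast; rfl
  rw [← this, sum_sigma', sum_sigma']
  refine sum_bij' (fun p _ => ⟨insert p.2 p.1, p.2⟩) (fun p _ => ⟨p.1.erase p.2, p.2⟩)
    ?_ ?_ ?_ ?_ ?_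
  · rintro ⟨I, i⟩ h
    simp only [mem_sigma, mem_powersetCard, subset_univ, true_and, mem_compl] at h ⊢
    exact ⟨by rw [card_insert_of_notMem h.2, h.1], mem_insert_self _ _⟩
  · rintro ⟨I, i⟩ h
    simp only [mem_sigma, mem_powersetCard, subset_univ, true_and, mem_compl] at h ⊢
    exact ⟨by rw [card_erase_of_mem h.2, h.1]; rfl, notMem_erase _ _⟩
  · rintro ⟨I, i⟩ h
    simp only [mem_sigma, mem_compl] at h
    simp [erase_insert h.2]
  · rintro ⟨I, i⟩ h
    simp only [mem_sigma] at h
    simp [insert_erase h.2]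
  · simp

theorem sum_powersetCard_spanDeficiency_le (u : ι → E) (B : ℝ) (hB₀ : 0 < B)
    (hu : ∀ e : E, ∑ i, ‖inner 𝕜 e (u i)‖ ^ 2 = ‖e‖ ^ 2) (hB : ∀ i, ‖u i‖ ^ 2 ≤ B)
    (hB₁ : 1 ≤ Fintype.card ι * B) (j : ℕ) :
    ∑ I ∈ powersetCard j univ, spanDeficiency 𝕜 u I ≤
      (Fintype.card ι).choose j * ((1 - 1 / (Fintype.card ι * B)) ^ j * finrank 𝕜 E) := by
  set q : ℝ := 1 - 1 / (Fintype.card ι * B) with hq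
  have hq₀ : 0 ≤ q := by
    rw [hq, sub_nonneg]; exact div_le_one_of_le₀ hB₁ (by positivity)
  induction j with
  | zero => simp [spanDeficiency]
  | succ j ih =>
    have hstep : ((j : ℝ) + 1) * ∑ I ∈ powersetCard (j + 1) univ, spanDeficiency 𝕜 u I ≤
        ((Fintype.card ι - j : ℕ) : ℝ) * q *
          ∑ I ∈ powersetCard j univ, spanDeficiency 𝕜 u I := by
      rw [← sum_powersetCard_sum_insert, mul_sum]
      refine sum_le_sum fun I hI => ?_
      have := sum_spanDeficiency_insert_le u B hB₀ hu hB I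
      rwa [(mem_powersetCard.1 hI).2] at this
    have hchoose : ((Fintype.card ι).choose (j + 1) : ℝ) * (j + 1) =
        (Fintype.card ι).choose j * ((Fintype.card ι - j : ℕ) : ℝ) := by
      exact_mod_cast Nat.choose_succ_right_eq _ _
    refine le_of_mul_le_mul_left (hstep.trans ?_) (by positivity : (0 : ℝ) < j + 1)
    calc _ ≤ ((Fintype.card ι - j : ℕ) : ℝ) * q *
            ((Fintype.card ι).choose j * (q ^ j * finrank 𝕜 E)) := by gcongr
      _ = ((Fintype.card ι).choose j * ((Fintype.card ι - j : ℕ) : ℝ)) *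
            (q ^ (j + 1) * finrank 𝕜 E) := by ring
      _ = _ := by rw [← hchoose]; ring

open Classical in
/-- Most sets of `m` vectors of a Parseval frame span the whole space. -/
theorem card_not_spanning_le (u : ι → E) (B : ℝ) (hB₀ : 0 < B)
    (hu : ∀ e : E, ∑ i, ‖inner 𝕜 e (u i)‖ ^ 2 = ‖e‖ ^ 2) (hB : ∀ i, ‖u i‖ ^ 2 ≤ B)
    (hB₁ : 1 ≤ Fintype.card ι * B) (m : ℕ) :
    (#{I ∈ powersetCard m univ |
        finrank 𝕜 (Submodule.span 𝕜 (u '' (I : Finset ι))) ≠ finrank 𝕜 E} : ℝ) ≤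
      (Fintype.card ι).choose m * (finrank 𝕜 E * Real.exp (-(m / (Fintype.card ι * B)))) := by
  have hq : (1 - 1 / (Fintype.card ι * B)) ^ m ≤ Real.exp (-(m / (Fintype.card ι * B))) := by
    have h₀ : 0 ≤ 1 - 1 / (Fintype.card ι * B) := by
      rw [sub_nonneg]; exact div_le_one_of_le₀ hB₁ (by positivity)
    have h₁ : 1 - 1 / (Fintype.card ι * B) ≤ Real.exp (-(1 / (Fintype.card ι * B))) :=
      Real.one_sub_le_exp_neg _
    refine (pow_le_pow_left₀ h₀ h₁ m).trans_eq ?_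
    rw [← Real.exp_nat_mul]
    congr 1; ring
  -- Markov's inequality, in counting form.
  calc _ = ∑ I ∈ powersetCard m univ with
          finrank 𝕜 (Submodule.span 𝕜 (u '' (I : Finset ι))) ≠ finrank 𝕜 E, (1 : ℝ) := by simp
    _ ≤ ∑ I ∈ powersetCard m univ with
          finrank 𝕜 (Submodule.span 𝕜 (u '' (I : Finset ι))) ≠ finrank 𝕜 E,
            spanDeficiency 𝕜 u I :=
        sum_le_sum fun I hI => one_le_spanDeficiency u I (mem_filter.1 hI).2
    _ ≤ ∑ I ∈ powersetCard m univ, spanDeficiency 𝕜 u I :=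
        sum_le_sum_of_subset_of_nonneg (filter_subset _ _)
          fun I _ _ => spanDeficiency_nonneg u I
    _ ≤ _ := sum_powersetCard_spanDeficiency_le u B hB₀ hu hB hB₁ m
    _ ≤ _ := by rw [mul_comm (finrank 𝕜 E : ℝ)]; gcongr

end Frame

/-! ### Incoherence, sampling probabilities and ranks -/

section Sampling

variable {𝕜 : Type*} [RCLike 𝕜] {N T r : ℕ}

theorem sum_norm_sq_row_le (U : Matrix (Fin N) (Fin r) 𝕜) (i : Fin N) :
    ∑ j, ‖U i j‖ ^ 2 ≤ twoInftyNorm U ^ 2 := by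
  have h : Real.sqrt (∑ j, ‖U i j‖ ^ 2) ≤ twoInftyNorm U :=
    le_ciSup (f := fun i => Real.sqrt (∑ j, ‖U i j‖ ^ 2)) (Set.finite_range _).bddAbove i
  rw [← Real.sq_sqrt (sum_nonneg fun j _ => sq_nonneg ‖U i j‖)]
  exact pow_le_pow_left₀ (Real.sqrt_nonneg _) h 2

/-- The rows of a matrix with orthonormal columns form a Parseval frame. -/
theorem sum_norm_sq_inner_row (U : Matrix (Fin N) (Fin r) 𝕜) (hU : Uᴴ * U = 1)
    (e : EuclideanSpace 𝕜 (Fin r)) :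
    ∑ i, ‖inner 𝕜 e (WithLp.toLp 2 (U i))‖ ^ 2 = ‖e‖ ^ 2 := by
  have h₁ : ∀ i, inner 𝕜 e (WithLp.toLp 2 (U i)) = (U *ᵥ star e.ofLp) i := by
    intro i
    simp [PiLp.inner_apply, Matrix.mulVec, dotProduct]
  have h₂ : star (U *ᵥ star e.ofLp) ⬝ᵥ (U *ᵥ star e.ofLp) = e.ofLp ⬝ᵥ star e.ofLp := by
    rw [Matrix.star_mulVec, ← Matrix.dotProduct_mulVec, Matrix.mulVec_mulVec, hU,
      Matrix.one_mulVec, star_star]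
  have h₃ : (((∑ i, ‖inner 𝕜 e (WithLp.toLp 2 (U i))‖ ^ 2 : ℝ)) : 𝕜) = ((‖e‖ ^ 2 : ℝ) : 𝕜) := by
    rw [EuclideanSpace.norm_sq_eq]
    push_cast
    simp_rw [h₁, ← RCLike.conj_mul]
    refine h₂.trans ?_
    simp [dotProduct, mul_comm]
  exact_mod_cast h₃

theorem rank_rowSubmatrix_eq_finrank_span (U : Matrix (Fin N) (Fin r) 𝕜) (I : Finset (Fin N)) :
    (rowSubmatrix U I).rank =
      finrank 𝕜 (Submodule.span 𝕜
        ((fun i => (WithLp.toLp 2 (U i) : EuclideanSpace 𝕜 (Fin r))) '' I)) := by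
  rw [Matrix.rank_eq_finrank_span_row,
    ← LinearEquiv.finrank_map_eq (WithLp.linearEquiv 2 𝕜 (Fin r → 𝕜)), Submodule.map_span]
  have : Set.range (rowSubmatrix U I).row = (WithLp.linearEquiv 2 𝕜 (Fin r → 𝕜)).toLinearMap ''
      ((fun i => (WithLp.toLp 2 (U i) : EuclideanSpace 𝕜 (Fin r))) '' I) := by
    rw [Set.image_image, Set.image_eq_range]
    rfl
  rw [this]

/-- Already `m ≥ r * μ * log (2 * r / δ)` gives `δ / 2`; the factor 3 and the division by `ε ^ 2`
are slack. -/
theorem natCast_mul_exp_le {m : ℕ} {μ δ ε : ℝ} (hr : 0 < r) (hμ : 1 ≤ μ)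
    (hδ₀ : 0 < δ) (hδ₁ : δ < 1) (hε₀ : 0 < ε) (hε₁ : ε < 1)
    (hm : 3 * r * μ * (Real.log (2 * r / δ) / ε ^ 2) ≤ (m : ℝ)) :
    r * Real.exp (-(m / (r * μ))) ≤ δ := by
  have hr₁ : (1 : ℝ) ≤ r := by exact_mod_cast hr
  have hlog : 0 ≤ Real.log (2 * r / δ) := by
    apply Real.log_nonneg
    rw [le_div_iff₀ hδ₀]; linarith
  have hrμ : 0 < r * μ := by positivity
  have hle : Real.log (2 * r / δ) ≤ m / (r * μ) := by
    rw [le_div_iff₀ hrμ]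
    refine le_trans ?_ hm
    have h₁ : Real.log (2 * r / δ) ≤ Real.log (2 * r / δ) / ε ^ 2 :=
      le_div_self hlog (by positivity) (pow_le_one₀ hε₀.le hε₁.le)
    have h₂ := mul_le_mul_of_nonneg_right h₁ hrμ.le
    have h₃ : 0 ≤ Real.log (2 * r / δ) / ε ^ 2 * (r * μ) := by positivity
    linarith
  calc r * Real.exp (-(m / (r * μ))) ≤ r * Real.exp (-Real.log (2 * r / δ)) := by gcongr
    _ = δ / 2 := by
        rw [Real.exp_neg, Real.exp_log (by positivity)]
        field_simp
    _ ≤ δ := by linarith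

/-- Sampled rows of an incoherent matrix with orthonormal columns have full column rank with high
probability. -/
theorem ofReal_le_uniformSubset_rank_eq (U : Matrix (Fin N) (Fin r) 𝕜) (hU : Uᴴ * U = 1)
    (hr : 0 < r) {μ δ ε : ℝ} (hμ : 1 ≤ μ) (hμN : μ ≤ (N : ℝ) / r)
    (hinc : (N : ℝ) / r * twoInftyNorm U ^ 2 ≤ μ)
    (hδ₀ : 0 < δ) (hδ₁ : δ < 1) (hε₀ : 0 < ε) (hε₁ : ε < 1) {m : ℕ} (hmN : m ≤ N)
    (hm : 3 * r * μ * (Real.log (2 * r / δ) / ε ^ 2) ≤ (m : ℝ)) :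
    ENNReal.ofReal (1 - δ) ≤
      (uniformSubset N m hmN).toOuterMeasure {I | (rowSubmatrix U I).rank = r} := by
  classical
  have hr₁ : (1 : ℝ) ≤ r := by exact_mod_cast hr
  have hN : (0 : ℝ) < N := by
    have : 0 < (N : ℝ) / r := by linarith
    by_contra h
    have : (N : ℝ) = 0 := le_antisymm (not_lt.1 h) (by positivity)
    simp_all
  have hNB : (N : ℝ) * (r * μ / N) = r * μ := by field_simp
  have hbad := card_not_spanning_le (𝕜 := 𝕜)
    (fun i => (WithLp.toLp 2 (U i) : EuclideanSpace 𝕜 (Fin r))) (r * μ / N) (by positivity)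
    (sum_norm_sq_inner_row U hU)
    (fun i => by
      rw [EuclideanSpace.norm_sq_eq, le_div_iff₀ hN]
      have h₁ := sum_norm_sq_row_le U i
      rw [div_mul_eq_mul_div, div_le_iff₀ (by positivity)] at hinc
      have h₂ := mul_le_mul_of_nonneg_right h₁ hN.le
      simp only
      linarith)
    (by rw [Fintype.card_fin, hNB]; nlinarith) m
  simp only [← rank_rowSubmatrix_eq_finrank_span, finrank_euclideanSpace, Fintype.card_fin, hNB]
    at hbad
  have hC : (0 : ℝ) < N.choose m := by exact_mod_cast Nat.choose_pos hmN
  have hbad' := hbad.trans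
    (mul_le_mul_of_nonneg_left (natCast_mul_exp_le hr hμ hδ₀ hδ₁ hε₀ hε₁ hm) hC.le)
  have hsplit : (#{I ∈ powersetCard m univ | (rowSubmatrix U I).rank = r} : ℝ) +
      #{I ∈ powersetCard m univ | (rowSubmatrix U I).rank ≠ r} = N.choose m := by
    have := card_filter_add_card_filter_not (s := powersetCard m (univ : Finset (Fin N)))
      (fun I => (rowSubmatrix U I).rank = r)
    rw [card_powersetCard, card_univ, Fintype.card_fin] at this
    exact_mod_cast this
  rw [uniformSubset, PMF.toOuterMeasure_uniformOfFinset_apply, card_powersetCard, card_univ,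
    Fintype.card_fin]
  simp only [Set.mem_ofPred_eq]
  rw [← ENNReal.ofReal_natCast, ← ENNReal.ofReal_natCast, ← ENNReal.ofReal_div_of_pos hC]
  refine ENNReal.ofReal_le_ofReal ?_
  rw [le_div_iff₀ hC]
  linarith

theorem subsetSampling_prod (m l : ℕ) (hm : m ≤ N) (hl : l ≤ T) (A : Set (Finset (Fin N)))
    (B : Set (Finset (Fin T))) :
    (subsetSampling N T m l hm hl).toOuterMeasure (A ×ˢ B) =
      (uniformSubset N m hm).toOuterMeasure A * (uniformSubset T l hl).toOuterMeasure B := by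
  classical
  rw [subsetSampling, PMF.toOuterMeasure_bind_apply, PMF.toOuterMeasure_apply (s := A),
    ← ENNReal.tsum_mul_right]
  refine tsum_congr fun I => ?_
  rw [PMF.toOuterMeasure_map_apply]
  by_cases h : I ∈ A
  · rw [Set.indicator_of_mem h, Set.mk_preimage_prod_right h]
  · rw [Set.indicator_of_notMem h, Set.mk_preimage_prod_right_eq_empty h]
    simp

theorem exists_leftInverse_of_rank_eq {m : Type*} [Fintype m] (A : Matrix m (Fin r) 𝕜)
    (h : A.rank = r) : ∃ L : Matrix (Fin r) m 𝕜, L * A = 1 := by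
  classical
  have hker : LinearMap.ker A.mulVecLin = ⊥ := by
    have := A.mulVecLin.finrank_range_add_finrank_ker
    rw [← Matrix.rank, h, finrank_fin_fun] at this
    exact Submodule.finrank_eq_zero.1 (by omega)
  obtain ⟨g, hg⟩ := A.mulVecLin.exists_leftInverse_of_injective hker
  refine ⟨LinearMap.toMatrix' g, ?_⟩
  rw [← LinearMap.toMatrix'_toLin' A, Matrix.toLin'_apply', ← LinearMap.toMatrix'_comp, hg, LinearMap.toMatrix'_id]

theorem rank_mul_diagonal_mul_conjTranspose {m n : Type*} [Fintype m] [Fintype n]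
    (A : Matrix m (Fin r) 𝕜) (B : Matrix n (Fin r) 𝕜) (d : Fin r → 𝕜) (hd : ∀ i, d i ≠ 0)
    (hA : A.rank = r) (hB : B.rank = r) :
    (A * Matrix.diagonal d * Bᴴ).rank = r := by
  obtain ⟨L, hL⟩ := exists_leftInverse_of_rank_eq A hA
  obtain ⟨R, hR⟩ := exists_leftInverse_of_rank_eq B hB
  have hR' : Bᴴ * Rᴴ = 1 := by rw [← Matrix.conjTranspose_mul, hR, Matrix.conjTranspose_one]
  apply le_antisymm
  · rw [Matrix.mul_assoc]
    exact (Matrix.rank_mul_le_left _ _).trans hA.le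
  · have hdiag : (Matrix.diagonal d).rank = r := by
      rw [Matrix.rank_of_det_ne_zero, Fintype.card_fin]
      rw [Matrix.det_diagonal]
      exact prod_ne_zero_iff.2 fun i _ => hd i
    -- One-sided inverses strip off the outer factors, so the product has rank at least that of the
    -- invertible diagonal.
    have heq : L * (A * Matrix.diagonal d * Bᴴ) * Rᴴ = Matrix.diagonal d := by
      rw [Matrix.mul_assoc A, ← Matrix.mul_assoc L, hL, Matrix.one_mul, Matrix.mul_assoc, hR',
        Matrix.mul_one]
    calc r = (L * (A * Matrix.diagonal d * Bᴴ) * Rᴴ).rank := by rw [heq, hdiag]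
      _ ≤ _ := (Matrix.rank_mul_le_left _ _).trans (Matrix.rank_mul_le_right _ _)

end Sampling

theorem mainTheorem2 {𝕜 : Type*} [RCLike 𝕜] {N T : ℕ} (X : Matrix (Fin N) (Fin T) 𝕜)
    (r : ℕ) (hr : 0 < r) (hrank : X.rank = r)
    (μ₁ μ₂ : ℝ) (hX : IsIncoherent X r μ₁ μ₂)
    (δ ε : ℝ) (hδ₀ : 0 < δ) (hδ₁ : δ < 1) (hε₀ : 0 < ε) (hε₁ : ε < 1)
    (m l : ℕ) (hm : m ≤ N) (hl : l ≤ T)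
    (hI : 3 * r * μ₁ * (Real.log (2 * r / δ) / ε ^ 2) ≤ (m : ℝ))
    (hJ : 3 * r * μ₂ * (Real.log (2 * r / δ) / ε ^ 2) ≤ (l : ℝ)) :
    ENNReal.ofReal (1 - δ) ≤
        (subsetSampling N T m l hm hl).toOuterMeasure
          {p | (rowSubmatrix X p.1).rank = r} ∧
      ENNReal.ofReal ((1 - δ) ^ 2) ≤
        (subsetSampling N T m l hm hl).toOuterMeasure
          {p | (rowColSubmatrix X p.1 p.2).rank = r} := by
  obtain ⟨⟨h₁, h₁N⟩, ⟨h₂, h₂T⟩, U, σ, V, hsvd, hU, hV⟩ := hX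
  have hσ : ∀ i, (σ i : 𝕜) ≠ 0 := fun i => by exact_mod_cast (hsvd.pos i).ne'
  have hrow := ofReal_le_uniformSubset_rank_eq U hsvd.left_orthonormal hr h₁ h₁N hU
    hδ₀ hδ₁ hε₀ hε₁ hm hI
  have hcol := ofReal_le_uniformSubset_rank_eq V hsvd.right_orthonormal hr h₂ h₂T hV
    hδ₀ hδ₁ hε₀ hε₁ hl hJ
  have hVrank : V.rank = r := by
    refine le_antisymm (Matrix.rank_le_width V) ?_
    have := Matrix.rank_mul_le_right Vᴴ V
    rwa [hsvd.right_orthonormal, Matrix.rank_one, Fintype.card_fin] at this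
  constructor
  · have huniv : (uniformSubset T l hl).toOuterMeasure Set.univ = 1 :=
      (PMF.toOuterMeasure_apply_eq_one_iff _ _).2 (Set.subset_univ _)
    rw [← mul_one (ENNReal.ofReal _), ← huniv]
    refine (mul_le_mul_left hrow _).trans ?_
    rw [← subsetSampling_prod m l hm hl]
    refine MeasureTheory.measure_mono ?_
    rintro ⟨I, J⟩ ⟨hI', -⟩
    have := rank_mul_diagonal_mul_conjTranspose (rowSubmatrix U I) V _ hσ hI' hVrank
    have heq : rowSubmatrix X I =
        rowSubmatrix U I * Matrix.diagonal (fun i => (σ i : 𝕜)) * Vᴴ := by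
      rw [hsvd.eq]; rfl
    simpa only [Set.mem_ofPred_eq, heq] using this
  · rw [sq, ENNReal.ofReal_mul (by linarith)]
    refine (mul_le_mul' hrow hcol).trans ?_
    rw [← subsetSampling_prod m l hm hl]
    refine MeasureTheory.measure_mono ?_
    rintro ⟨I, J⟩ ⟨hI', hJ'⟩
    have := rank_mul_diagonal_mul_conjTranspose (rowSubmatrix U I) (rowSubmatrix V J) _ hσ hI' hJ'
    have heq : rowColSubmatrix X I J =
        rowSubmatrix U I * Matrix.diagonal (fun i => (σ i : 𝕜)) * (rowSubmatrix V J)ᴴ := by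
      rw [hsvd.eq]; rfl
    simpa only [Set.mem_ofPred_eq, heq] using this
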